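/- Let $\lambda\in\mathbb{C}$, $\lambda\neq 0$, and let $\mathbb{R}^3_\lambda$ be the unital associative complex algebra generated by $x_1,x_2,x_3$ with relations $$[x_1,x_2]=2\lambda x_2,\qquad [x_1,x_3]=2\lambda x_3,\qquad [x_2,x_3]=0 .$$ Let $\rho$ be its representation on $\mathbb{C}^3$, with standard basis $e_1,e_2,e_3$, given by $$\rho(x_1)=\lambda\begin{pmatrix}1&0&0\\0&1&0\\0&0&-1\end{pmatrix},\quad \rho(x_2)=\lambda\begin{pmatrix}0&0&1\\0&0&0\\0&0&0\end{pmatrix},\quad \rho(x_3)=\lambda\begin{pmatrix}0&0&0\\0&0&1\\0&0&0\end{pmatrix},$$ and let $\Lambda=e_3$. Let $\Omega=\Omega(\mathbb{R}^3_\lambda)$ be the algebra of forms generated by $\mathbb{R}^3_\lambda$ and the basic one-forms $e_1,e_2,e_3$, with relations $$x_a e_i=e_i x_a+\rho(x_a)e_i,\qquad e_i\wedge e_j=-e_j\wedge e_i\qquad(a,i,j\in\{1,2,3\}),$$ where $\rho(x_a)e_i\in\mathbb{C}^3$ is read as a combination of the one-forms $e_1,e_2,e_3$. Let $\Omega^k$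 be the span of the products $e_{i_1}\wedge\dots\wedge e_{i_k}f$ with $f\in\mathbb{R}^3_\lambda$, so that $\Omega^0=\mathbb{R}^3_\lambda$. Let $\mathrm{d}:\Omega^k\to\Omega^{k+1}$ be the linear map determined by $$\mathrm{d}x_a=\lambda^{-1}\rho(x_a)\Lambda,\qquad \mathrm{d}e_i=0,\qquad \mathrm{d}(\omega\wedge\eta)=\omega\wedge\mathrm{d}\eta+(-1)^{\deg\eta}\,\mathrm{d}\omega\wedge\eta ;$$ it satisfies $\mathrm{d}^2=0$. Let $H^k=\{\omega\in\Omega^k:\mathrm{d}\omega=0\}/\mathrm{d}\Omega^{k-1}$ be the cohomology of this complex (with $\Omega^{-1}=0$). **Theorem.** $H^0=\mathbb{C}\cdot 1$, that is, $H^0$ is the one-dimensional space spanned by the class of $1$, and $H^1=H^2=H^3=\{0\}$. -/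

import Mathlib

noncomputable section

namespace R3Calculus

/-! ### The coordinate algebra and its representation

The indices `1, 2, 3` of the coordinates and of the basis vectors are written `0, 1, 2 : Fin 3`. -/

/-- The relations `[x₁,x₂] = 2λ x₂`, `[x₁,x₃] = 2λ x₃`, `[x₂,x₃] = 0`, in any algebra. -/
inductive BorelRel (lam : ℂ) {A : Type} [Ring A] [Algebra ℂ A] (x : Fin 3 → A) : A → A → Prop
  | comm12 : BorelRel lam x (x 0 * x 1) (x 1 * x 0 + (2 * lam) • x 1)
  | comm13 : BorelRel lam x (x 0 * x 2) (x 2 * x 0 + (2 * lam) • x 2)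
  | comm23 : BorelRel lam x (x 1 * x 2) (x 2 * x 1)

/-- The algebra `ℝ³_λ`: the unital associative complex algebra generated by `x₁, x₂, x₃`
subject to the relations `BorelRel`. -/
def R3 (lam : ℂ) : Type := RingQuot (BorelRel lam (FreeAlgebra.ι ℂ (X := Fin 3)))

instance (lam : ℂ) : Ring (R3 lam) :=
  inferInstanceAs (Ring (RingQuot (BorelRel lam (FreeAlgebra.ι ℂ (X := Fin 3)))))

instance (lam : ℂ) : Algebra ℂ (R3 lam) :=
  inferInstanceAs (Algebra ℂ (RingQuot (BorelRel lam (FreeAlgebra.ι ℂ (X := Fin 3)))))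

/-- The quotient map from the free algebra. -/
def R3.mk (lam : ℂ) : FreeAlgebra ℂ (Fin 3) →ₐ[ℂ] R3 lam :=
  RingQuot.mkAlgHom ℂ (BorelRel lam (FreeAlgebra.ι ℂ (X := Fin 3)))

theorem R3.mk_rel (lam : ℂ) {p q : FreeAlgebra ℂ (Fin 3)}
    (h : BorelRel lam (FreeAlgebra.ι ℂ) p q) : R3.mk lam p = R3.mk lam q :=
  RingQuot.mkAlgHom_rel ℂ h

theorem R3.mk_surjective (lam : ℂ) : Function.Surjective (R3.mk lam) :=
  RingQuot.mkAlgHom_surjective ℂ _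

/-- The coordinate `x_a` in `ℝ³_λ`. -/
def x (lam : ℂ) (a : Fin 3) : R3 lam := R3.mk lam (FreeAlgebra.ι ℂ a)

theorem x_comm12 (lam : ℂ) :
    x lam 0 * x lam 1 = x lam 1 * x lam 0 + (2 * lam) • x lam 1 := by
  simpa only [x, map_mul, map_add, map_smul] using R3.mk_rel lam BorelRel.comm12

theorem x_comm13 (lam : ℂ) :
    x lam 0 * x lam 2 = x lam 2 * x lam 0 + (2 * lam) • x lam 2 := by
  simpa only [x, map_mul, map_add, map_smul] using R3.mk_rel lam BorelRel.comm13

theorem x_comm23 (lam : ℂ) : x lam 1 * x lam 2 = x lam 2 * x lam 1 := by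
  simpa only [x, map_mul] using R3.mk_rel lam BorelRel.comm23

/-- The algebra map out of `ℝ³_λ` given by three elements that satisfy the relations. -/
def R3.lift (lam : ℂ) {A : Type} [Ring A] [Algebra ℂ A] (y : Fin 3 → A)
    (h12 : y 0 * y 1 = y 1 * y 0 + (2 * lam) • y 1)
    (h13 : y 0 * y 2 = y 2 * y 0 + (2 * lam) • y 2)
    (h23 : y 1 * y 2 = y 2 * y 1) : R3 lam →ₐ[ℂ] A :=
  RingQuot.liftAlgHom ℂ ⟨FreeAlgebra.lift ℂ y, by
    rintro _ _ (_ | _ | _)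
    · simpa using h12
    · simpa using h13
    · simpa using h23⟩

theorem R3.lift_x (lam : ℂ) {A : Type} [Ring A] [Algebra ℂ A] (y : Fin 3 → A)
    (h12 : y 0 * y 1 = y 1 * y 0 + (2 * lam) • y 1)
    (h13 : y 0 * y 2 = y 2 * y 0 + (2 * lam) • y 2)
    (h23 : y 1 * y 2 = y 2 * y 1) (a : Fin 3) :
    R3.lift lam y h12 h13 h23 (x lam a) = y a := by
  exact (RingQuot.liftAlgHom_mkAlgHom_apply ℂ _ _ _).trans (FreeAlgebra.lift_ι_apply _ _)

/-- Two algebra maps out of `ℝ³_λ` agree when they agree on the coordinates. -/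
theorem R3.algHom_ext (lam : ℂ) {A : Type} [Ring A] [Algebra ℂ A] {f g : R3 lam →ₐ[ℂ] A}
    (hX : ∀ a, f (x lam a) = g (x lam a)) : f = g := by
  have h : f.comp (R3.mk lam) = g.comp (R3.mk lam) := FreeAlgebra.hom_ext (funext hX)
  ext p
  obtain ⟨w, rfl⟩ := R3.mk_surjective lam p
  exact DFunLike.congr_fun h w

/-- The matrices `ρ(x₁), ρ(x₂), ρ(x₃)`. -/
def repMat (lam : ℂ) : Fin 3 → Matrix (Fin 3) (Fin 3) ℂ :=
  ![lam • !![1, 0, 0; 0, 1, 0; 0, 0, -1],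
    lam • !![0, 0, 1; 0, 0, 0; 0, 0, 0],
    lam • !![0, 0, 0; 0, 0, 1; 0, 0, 0]]

theorem repMat_comm12 (lam : ℂ) : repMat lam 0 * repMat lam 1
    = repMat lam 1 * repMat lam 0 + (2 * lam) • repMat lam 1 := by
  ext i j; fin_cases i <;> fin_cases j <;>
    simp [repMat, Matrix.mul_apply, Fin.sum_univ_three]
  ring

theorem repMat_comm13 (lam : ℂ) : repMat lam 0 * repMat lam 2
    = repMat lam 2 * repMat lam 0 + (2 * lam) • repMat lam 2 := by
  ext i j; fin_cases i <;> fin_cases j <;>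
    simp [repMat, Matrix.mul_apply, Fin.sum_univ_three]
  ring

theorem repMat_comm23 (lam : ℂ) : repMat lam 1 * repMat lam 2
    = repMat lam 2 * repMat lam 1 := by
  ext i j; fin_cases i <;> fin_cases j <;>
    simp [repMat, Matrix.mul_apply, Fin.sum_univ_three]

/-- The representation `ρ` of `ℝ³_λ` on `V_ρ = ℂ³`. -/
def rho (lam : ℂ) : R3 lam →ₐ[ℂ] Matrix (Fin 3) (Fin 3) ℂ :=
  R3.lift lam (repMat lam)
    (repMat_comm12 lam) (repMat_comm13 lam) (repMat_comm23 lam)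

theorem rho_x (lam : ℂ) (a : Fin 3) : rho lam (x lam a) = repMat lam a :=
  R3.lift_x ..

/-- The basis vector `e_i` of `V_ρ = ℂ³`. -/
def basisVec (i : Fin 3) : Fin 3 → ℂ := Pi.single i 1

/-- The vector `Λ = e₃`. -/
def bigLambda : Fin 3 → ℂ := basisVec 2

/-- `ρ_Λ(h) = ρ(h)·Λ`. -/
def rhoLambda (lam : ℂ) (h : R3 lam) : Fin 3 → ℂ := (rho lam h).mulVec bigLambda

/-! ### The exterior algebra of forms -/

/-- The generator `x_a` of the free algebra on `x₁, x₂, x₃, e₁, e₂, e₃`. -/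
def genX (a : Fin 3) : FreeAlgebra ℂ (Fin 3 ⊕ Fin 3) := FreeAlgebra.ι ℂ (Sum.inl a)

/-- The vector `v = ∑ v_i e_i` of `V_ρ` in the free algebra on `x₁, x₂, x₃, e₁, e₂, e₃`. -/
def genV (v : Fin 3 → ℂ) : FreeAlgebra ℂ (Fin 3 ⊕ Fin 3) :=
  ∑ i, v i • FreeAlgebra.ι ℂ (Sum.inr i)

/-- The relations of the exterior algebra of forms: those of `ℝ³_λ`, the commutation relations
`x_a v = v x_a + ρ(x_a)·v` with the basic one-forms `v = e_i`, and the anticommutation of the basic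
one-forms (for `i = j` it reads `e_i ∧ e_i = 0`). -/
inductive FormRel (lam : ℂ) :
    FreeAlgebra ℂ (Fin 3 ⊕ Fin 3) → FreeAlgebra ℂ (Fin 3 ⊕ Fin 3) → Prop
  | coord {p q : FreeAlgebra ℂ (Fin 3 ⊕ Fin 3)} (h : BorelRel lam genX p q) : FormRel lam p q
  | bimod (a i : Fin 3) : FormRel lam (genX a * genV (basisVec i))
      (genV (basisVec i) * genX a + genV ((rho lam (x lam a)).mulVec (basisVec i)))
  | wedge (i j : Fin 3) : FormRel lam (genV (basisVec i) * genV (basisVec j))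
      (-(genV (basisVec j) * genV (basisVec i)))

/-- The algebra `Ω(ℝ³_λ)` of forms; its product is the wedge product. -/
def Forms (lam : ℂ) : Type := RingQuot (FormRel lam)

instance (lam : ℂ) : Ring (Forms lam) := inferInstanceAs (Ring (RingQuot (FormRel lam)))

instance (lam : ℂ) : Algebra ℂ (Forms lam) :=
  inferInstanceAs (Algebra ℂ (RingQuot (FormRel lam)))

/-- The quotient map from the free algebra. -/
def Forms.mk (lam : ℂ) : FreeAlgebra ℂ (Fin 3 ⊕ Fin 3) →ₐ[ℂ] Forms lam :=
  RingQuot.mkAlgHom ℂ (FormRel lam)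

theorem Forms.mk_rel (lam : ℂ) {p q : FreeAlgebra ℂ (Fin 3 ⊕ Fin 3)}
    (h : FormRel lam p q) : Forms.mk lam p = Forms.mk lam q :=
  RingQuot.mkAlgHom_rel ℂ h

theorem Forms.mk_surjective (lam : ℂ) : Function.Surjective (Forms.mk lam) :=
  RingQuot.mkAlgHom_surjective ℂ _

/-- The coordinate `x_a` as a zero-form. -/
def formX (lam : ℂ) (a : Fin 3) : Forms lam := Forms.mk lam (genX a)

/-- The invariant one-forms: the linear map `V_ρ = Λ¹ → Ω(ℝ³_λ)`. -/
def formV (lam : ℂ) : (Fin 3 → ℂ) →ₗ[ℂ] Forms lam :=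
  Fintype.linearCombination ℂ
    (fun i => Forms.mk lam (FreeAlgebra.ι ℂ (Sum.inr i)))

theorem mk_genV (lam : ℂ) (v : Fin 3 → ℂ) :
    Forms.mk lam (genV v) = formV lam v := by
  simp [genV, formV, Fintype.linearCombination_apply]

theorem vec_eq_sum (v : Fin 3 → ℂ) : v = ∑ i, v i • basisVec i := by
  ext j; simp [basisVec, Finset.sum_apply, Pi.single_apply]

theorem formX_bimod_basis (lam : ℂ) (a i : Fin 3) :
    formX lam a * formV lam (basisVec i) = formV lam (basisVec i) * formX lam a
      + formV lam ((rho lam (x lam a)).mulVec (basisVec i)) := by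
  have := Forms.mk_rel lam (FormRel.bimod a i)
  simpa [mk_genV, formX] using this

theorem formX_bimod (lam : ℂ) (a : Fin 3) (v : Fin 3 → ℂ) :
    formX lam a * formV lam v = formV lam v * formX lam a
      + formV lam ((rho lam (x lam a)).mulVec v) := by
  rw [vec_eq_sum v]
  simp only [map_sum, map_smul, Matrix.mulVec_sum, Matrix.mulVec_smul, Finset.mul_sum,
    Finset.sum_mul, mul_smul_comm, smul_mul_assoc, formX_bimod_basis, smul_add,
    Finset.sum_add_distrib]

theorem formV_wedge_basis (lam : ℂ) (i j : Fin 3) :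
    formV lam (basisVec i) * formV lam (basisVec j)
      = -(formV lam (basisVec j) * formV lam (basisVec i)) := by
  have := Forms.mk_rel lam (FormRel.wedge i j)
  simpa [mk_genV] using this

theorem formV_wedge (lam : ℂ) (v w : Fin 3 → ℂ) :
    formV lam v * formV lam w = -(formV lam w * formV lam v) := by
  rw [vec_eq_sum v, vec_eq_sum w]
  simp only [map_sum, map_smul, Finset.mul_sum, Finset.sum_mul, mul_smul_comm, smul_mul_assoc,
    Finset.smul_sum]
  rw [Finset.sum_comm, ← Finset.sum_neg_distrib]
  refine Finset.sum_congr rfl fun j _ => ?_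
  rw [← Finset.sum_neg_distrib]
  refine Finset.sum_congr rfl fun i _ => ?_
  rw [formV_wedge_basis, smul_neg, smul_neg, smul_comm]

theorem formX_comm12 (lam : ℂ) :
    formX lam 0 * formX lam 1 = formX lam 1 * formX lam 0 + (2 * lam) • formX lam 1 := by
  simpa only [formX, map_mul, map_add, map_smul] using
    Forms.mk_rel lam (FormRel.coord BorelRel.comm12)

theorem formX_comm13 (lam : ℂ) :
    formX lam 0 * formX lam 2 = formX lam 2 * formX lam 0 + (2 * lam) • formX lam 2 := by
  simpa only [formX, map_mul, map_add, map_smul] using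
    Forms.mk_rel lam (FormRel.coord BorelRel.comm13)

theorem formX_comm23 (lam : ℂ) :
    formX lam 1 * formX lam 2 = formX lam 2 * formX lam 1 := by
  simpa only [formX, map_mul, map_add, map_smul] using
    Forms.mk_rel lam (FormRel.coord BorelRel.comm23)

/-- The inclusion of `ℝ³_λ` as the algebra of zero-forms. -/
def ofR3 (lam : ℂ) : R3 lam →ₐ[ℂ] Forms lam :=
  R3.lift lam (formX lam) (formX_comm12 lam) (formX_comm13 lam) (formX_comm23 lam)

theorem ofR3_x (lam : ℂ) (a : Fin 3) : ofR3 lam (x lam a) = formX lam a := R3.lift_x ..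

/-- The algebra map out of `Ω(ℝ³_λ)` given by images of the generators that satisfy the
relations. -/
def Forms.lift (lam : ℂ) {A : Type} [Ring A] [Algebra ℂ A] (y : Fin 3 → A)
    (E : (Fin 3 → ℂ) →ₗ[ℂ] A)
    (h12 : y 0 * y 1 = y 1 * y 0 + (2 * lam) • y 1)
    (h13 : y 0 * y 2 = y 2 * y 0 + (2 * lam) • y 2)
    (h23 : y 1 * y 2 = y 2 * y 1)
    (hb : ∀ a v, y a * E v = E v * y a + E ((rho lam (x lam a)).mulVec v))
    (hw : ∀ v w, E v * E w = -(E w * E v)) : Forms lam →ₐ[ℂ] A :=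
  RingQuot.liftAlgHom ℂ
    ⟨FreeAlgebra.lift ℂ (Sum.elim y fun i => E (basisVec i)), by
      have hX : ∀ a, FreeAlgebra.lift ℂ (Sum.elim y fun i => E (basisVec i)) (genX a) = y a := by
        intro a; simp [genX]
      have hV : ∀ v, FreeAlgebra.lift ℂ (Sum.elim y fun i => E (basisVec i)) (genV v) = E v := by
        intro v
        conv_rhs => rw [vec_eq_sum v]
        simp [genV]
      rintro _ _ (⟨_ | _ | _⟩ | ⟨a, i⟩ | ⟨i, j⟩)
      · simpa only [map_mul, map_add, map_smul, hX] using h12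
      · simpa only [map_mul, map_add, map_smul, hX] using h13
      · simpa only [map_mul, hX] using h23
      · simpa only [map_mul, map_add, hX, hV] using hb a _
      · simpa only [map_mul, map_neg, hV] using hw _ _⟩

section
variable (lam : ℂ) {A : Type} [Ring A] [Algebra ℂ A] (y : Fin 3 → A)
    (E : (Fin 3 → ℂ) →ₗ[ℂ] A)
    (h12 : y 0 * y 1 = y 1 * y 0 + (2 * lam) • y 1)
    (h13 : y 0 * y 2 = y 2 * y 0 + (2 * lam) • y 2)
    (h23 : y 1 * y 2 = y 2 * y 1)
    (hb : ∀ a v, y a * E v = E v * y a + E ((rho lam (x lam a)).mulVec v))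
    (hw : ∀ v w, E v * E w = -(E w * E v))

theorem Forms.lift_X (a : Fin 3) :
    Forms.lift lam y E h12 h13 h23 hb hw (formX lam a) = y a := by
  exact (RingQuot.liftAlgHom_mkAlgHom_apply ℂ _ _ _).trans (FreeAlgebra.lift_ι_apply _ _)

theorem Forms.lift_V (v : Fin 3 → ℂ) :
    Forms.lift lam y E h12 h13 h23 hb hw (formV lam v) = E v := by
  have hi : ∀ i, Forms.lift lam y E h12 h13 h23 hb hw
      (Forms.mk lam (FreeAlgebra.ι ℂ (Sum.inr i))) = E (basisVec i) := fun i =>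
    (RingQuot.liftAlgHom_mkAlgHom_apply ℂ _ _ _).trans (FreeAlgebra.lift_ι_apply _ _)
  conv_rhs => rw [vec_eq_sum v]
  simp [formV, Fintype.linearCombination_apply, hi]

end

theorem ofR3_injective (lam : ℂ) : Function.Injective (ofR3 lam) := by
  have key : (Forms.lift lam (x lam) 0 (x_comm12 lam) (x_comm13 lam) (x_comm23 lam)
      (by simp) (by simp)).comp (ofR3 lam)
      = AlgHom.id ℂ _ := by
    apply R3.algHom_ext
    intro a
    rw [AlgHom.comp_apply, ofR3_x, Forms.lift_X, AlgHom.id_apply]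
  exact Function.LeftInverse.injective fun f => DFunLike.congr_fun key f

/-! ### The exterior derivative -/

/-- The differential of a coordinate, `dx_a = λ⁻¹ ρ_Λ(x_a)`. -/
def dCoord (lam : ℂ) (a : Fin 3) : Forms lam := lam⁻¹ • formV lam (rhoLambda lam (x lam a))

/-- Upper triangular matrices `(p, q; 0, r)` over the forms. -/
def tri (lam : ℂ) (p q r : Forms lam) : Matrix (Fin 2) (Fin 2) (Forms lam) := !![p, q; 0, r]

theorem tri_mul (lam : ℂ) (p q r p' q' r' : Forms lam) :
    tri lam p q r * tri lam p' q' r' = tri lam (p * p') (p * q' + q * r') (r * r') := by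
  simp [tri]

theorem tri_add (lam : ℂ) (p q r p' q' r' : Forms lam) :
    tri lam p q r + tri lam p' q' r' = tri lam (p + p') (q + q') (r + r') := by
  ext i j; fin_cases i <;> fin_cases j <;> simp [tri]

theorem tri_smul (lam c : ℂ) (p q r : Forms lam) :
    c • tri lam p q r = tri lam (c • p) (c • q) (c • r) := by
  ext i j; fin_cases i <;> fin_cases j <;> simp [tri]

theorem tri_neg (lam : ℂ) (p q r : Forms lam) :
    -tri lam p q r = tri lam (-p) (-q) (-r) := by
  ext i j; fin_cases i <;> fin_cases j <;> simp [tri]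

theorem dCoord_comm (lam c : ℂ) (a b : Fin 3)
    (h : repMat lam a * repMat lam b = repMat lam b * repMat lam a + c • repMat lam b) :
    formX lam a * dCoord lam b + dCoord lam a * formX lam b
      = formX lam b * dCoord lam a + dCoord lam b * formX lam a + c • dCoord lam b := by
  have h' : (rho lam (x lam a)).mulVec (rhoLambda lam (x lam b))
      = (rho lam (x lam b)).mulVec (rhoLambda lam (x lam a)) + c • rhoLambda lam (x lam b) := by
    simp only [rhoLambda, Matrix.mulVec_mulVec, rho_x, h, Matrix.add_mulVec, Matrix.smul_mulVec]
  simp only [dCoord, mul_smul_comm, smul_mul_assoc, formX_bimod, h', map_add, map_smul, smul_add]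
  rw [smul_comm c lam⁻¹]
  abel

/-- The map `v ↦ (v, 0; 0, -v)` on invariant one-forms. -/
def triV (lam : ℂ) : (Fin 3 → ℂ) →ₗ[ℂ] Matrix (Fin 2) (Fin 2) (Forms lam) where
  toFun v := tri lam (formV lam v) 0 (-formV lam v)
  map_add' v w := by rw [tri_add]; simp [add_comm]
  map_smul' c v := by simp [tri_smul]

/-- The algebra map `ω ↦ (ω, dω; 0, (-1)^{deg ω} ω)` that encodes the right-handed super
derivation `d` with `d x_a = λ⁻¹ ρ_Λ(x_a)` and `d v = 0` for invariant one-forms `v`. -/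
def triHom (lam : ℂ) : Forms lam →ₐ[ℂ] Matrix (Fin 2) (Fin 2) (Forms lam) :=
  Forms.lift lam (fun a => tri lam (formX lam a) (dCoord lam a) (formX lam a)) (triV lam)
    (by
      simp only [tri_mul, tri_add, tri_smul, formX_comm12]
      rw [dCoord_comm lam (2 * lam) 0 1 (repMat_comm12 lam)])
    (by
      simp only [tri_mul, tri_add, tri_smul, formX_comm13]
      rw [dCoord_comm lam (2 * lam) 0 2 (repMat_comm13 lam)])
    (by
      simp only [tri_mul, formX_comm23]
      rw [dCoord_comm lam 0 1 2 (by rw [repMat_comm23, zero_smul, add_zero]), zero_smul, add_zero])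
    (by
      intro a v
      change tri lam _ _ _ * tri lam _ _ _ = tri lam _ _ _ * tri lam _ _ _ + tri lam _ _ _
      simp only [tri_mul, tri_add, formX_bimod, mul_neg, neg_mul, mul_zero, zero_add, zero_mul,
        add_zero, neg_add]
      rw [dCoord, smul_mul_assoc, formV_wedge, mul_smul_comm, smul_neg, neg_neg])
    (by
      intro v w
      change tri lam _ _ _ * tri lam _ _ _ = -(tri lam _ _ _ * tri lam _ _ _)
      simp only [tri_mul, tri_neg, mul_zero, zero_mul, add_zero, neg_zero, neg_mul_neg]
      rw [formV_wedge])

/-- The exterior derivative `d` on the forms. -/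
def extD (lam : ℂ) : Forms lam →ₗ[ℂ] Forms lam where
  toFun ω := triHom lam ω 0 1
  map_add' := by simp
  map_smul' := by simp

/-- The parity automorphism `ω ↦ (-1)^{deg ω} ω`. -/
def parity (lam : ℂ) : Forms lam →ₐ[ℂ] Forms lam :=
  Forms.lift lam (formX lam) (-formV lam) (formX_comm12 lam) (formX_comm13 lam) (formX_comm23 lam)
    (by intro a v; simp [formX_bimod]; abel)
    (by intro v w; simpa using formV_wedge lam v w)

theorem parity_X (lam : ℂ) (a : Fin 3) : parity lam (formX lam a) = formX lam a :=
  Forms.lift_X ..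

theorem parity_V (lam : ℂ) (v : Fin 3 → ℂ) : parity lam (formV lam v) = -formV lam v :=
  Forms.lift_V ..

theorem triHom_X (lam : ℂ) (a : Fin 3) :
    triHom lam (formX lam a) = tri lam (formX lam a) (dCoord lam a) (formX lam a) :=
  Forms.lift_X ..

theorem triHom_V (lam : ℂ) (v : Fin 3 → ℂ) :
    triHom lam (formV lam v) = tri lam (formV lam v) 0 (-formV lam v) :=
  Forms.lift_V ..

theorem extD_X (lam : ℂ) (a : Fin 3) : extD lam (formX lam a) = dCoord lam a := by
  simp [extD, triHom_X, tri]

theorem extD_V (lam : ℂ) (v : Fin 3 → ℂ) : extD lam (formV lam v) = 0 := by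
  simp [extD, triHom_V, tri]

/-- Induction on the generators of the algebra of forms. -/
theorem Forms.induct (lam : ℂ) (P : Forms lam → Prop)
    (hX : ∀ a, P (formX lam a)) (hV : ∀ v, P (formV lam v))
    (hC : ∀ c : ℂ, P (algebraMap ℂ _ c)) (hadd : ∀ p q, P p → P q → P (p + q))
    (hmul : ∀ p q, P p → P q → P (p * q)) (ω : Forms lam) : P ω := by
  obtain ⟨w, rfl⟩ := Forms.mk_surjective lam ω
  induction w using FreeAlgebra.induction with
  | grade0 c => rw [AlgHom.commutes]; exact hC c
  | grade1 s =>
    rcases s with a | i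
    · exact hX a
    · have := hV (basisVec i)
      rwa [← mk_genV, genV, Finset.sum_eq_single i (by intro b _ hb; simp [basisVec, hb])
        (by simp), basisVec, Pi.single_eq_same, one_smul] at this
  | mul p q hp hq => rw [map_mul]; exact hmul _ _ hp hq
  | add p q hp hq => rw [map_add]; exact hadd _ _ hp hq

theorem triHom_eq (lam : ℂ) (ω : Forms lam) :
    triHom lam ω = tri lam ω (extD lam ω) (parity lam ω) := by
  have aux : triHom lam ω 0 0 = ω ∧ triHom lam ω 1 0 = 0 ∧ triHom lam ω 1 1 = parity lam ω := by
    induction ω using Forms.induct with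
    | hX a => rw [triHom_X, parity_X]; simp [tri]
    | hV v => rw [triHom_V, parity_V]; simp [tri]
    | hC c => simp [Matrix.algebraMap_matrix_apply]
    | hadd p q hp hq => simp [hp, hq]
    | hmul p q hp hq => simp [Matrix.mul_apply, Fin.sum_univ_two, hp, hq]
  ext i j
  fin_cases i <;> fin_cases j
  · exact aux.1
  · rfl
  · exact aux.2.1
  · exact aux.2.2

/-- The right-handed super Leibniz rule `d(ω ∧ η) = ω ∧ dη + (-1)^{deg η} dω ∧ η`. -/
theorem extD_mul (lam : ℂ) (ω η : Forms lam) :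
    extD lam (ω * η) = ω * extD lam η + extD lam ω * parity lam η := by
  have h := map_mul (triHom lam) ω η
  rw [triHom_eq, triHom_eq, triHom_eq, tri_mul] at h
  simpa [tri] using congrFun (congrFun h 0) 1

theorem extD_algebraMap (lam c : ℂ) : extD lam (algebraMap ℂ _ c) = 0 := by
  simp [extD, Matrix.algebraMap_matrix_apply]

theorem extD_parity (lam : ℂ) (ω : Forms lam) :
    parity lam (extD lam ω) = -extD lam (parity lam ω) := by
  induction ω using Forms.induct with
  | hX a => simp [extD_X, parity_X, dCoord, parity_V]
  | hV v => simp [extD_V, parity_V]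
  | hC c => simp [extD_algebraMap]
  | hadd p q hp hq => simp only [map_add, hp, hq, neg_add]
  | hmul p q hp hq =>
    simp only [extD_mul, map_mul, map_add, hp, hq, mul_neg, neg_mul, neg_add]

theorem extD_extD (lam : ℂ) (ω : Forms lam) : extD lam (extD lam ω) = 0 := by
  induction ω using Forms.induct with
  | hX a => simp [extD_X, dCoord, extD_V]
  | hV v => simp [extD_V]
  | hC c => simp [extD_algebraMap]
  | hadd p q hp hq => simp [hp, hq]
  | hmul p q hp hq => simp [extD_mul, hp, hq, extD_parity]

/-! ### The complex and its cohomology -/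

/-- The space `Ω^k` of forms of degree `k`: the span of the products
`v₁ ∧ ⋯ ∧ v_k f` with invariant one-forms `v_i` and `f` in `ℝ³_λ`. In particular `Ω^0` is the
copy of `ℝ³_λ` inside the forms. -/
def formsDeg (lam : ℂ) (k : ℕ) : Submodule ℂ (Forms lam) :=
  (LinearMap.range (formV lam)) ^ k * Subalgebra.toSubmodule (ofR3 lam).range

/-- Closed `k`-forms. -/
def closedForms (lam : ℂ) (k : ℕ) : Submodule ℂ (Forms lam) :=
  formsDeg lam k ⊓ LinearMap.ker (extD lam)

/-- Exact `k`-forms. -/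
def exactForms (lam : ℂ) : ℕ → Submodule ℂ (Forms lam)
  | 0 => ⊥
  | k + 1 => (formsDeg lam k).map (extD lam)

theorem R3.induct (lam : ℂ) (P : R3 lam → Prop) (hX : ∀ a, P (x lam a))
    (hC : ∀ c : ℂ, P (algebraMap ℂ _ c)) (hadd : ∀ p q, P p → P q → P (p + q))
    (hmul : ∀ p q, P p → P q → P (p * q)) (f : R3 lam) : P f := by
  obtain ⟨w, rfl⟩ := R3.mk_surjective lam f
  induction w using FreeAlgebra.induction with
  | grade0 c => rw [AlgHom.commutes]; exact hC c
  | grade1 a => exact hX a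
  | mul p q hp hq => rw [map_mul]; exact hmul _ _ hp hq
  | add p q hp hq => rw [map_add]; exact hadd _ _ hp hq

theorem formsDeg_mul_right (lam : ℂ) (k : ℕ) {ω : Forms lam} (h : ω ∈ formsDeg lam k)
    (f : R3 lam) : ω * ofR3 lam f ∈ formsDeg lam k := by
  have h1 : ω * ofR3 lam f ∈ formsDeg lam k * Subalgebra.toSubmodule (ofR3 lam).range :=
    Submodule.mul_mem_mul h ⟨f, rfl⟩
  rwa [formsDeg, mul_assoc, (Subalgebra.isIdempotentElem_toSubmodule _).eq] at h1

/-- `Ω^1` is stable under left multiplication by zero-forms. -/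
theorem formsDeg_one_mul_left (lam : ℂ) (f : R3 lam) :
    ∀ ω ∈ formsDeg lam 1, ofR3 lam f * ω ∈ formsDeg lam 1 := by
  induction f using R3.induct with
  | hX a =>
    intro ω h
    rw [formsDeg, pow_one] at h
    induction h using Submodule.mul_induction_on' with
    | mem_mul_mem v hv g hg =>
      obtain ⟨v, rfl⟩ := hv
      rw [ofR3_x, ← mul_assoc, formX_bimod, add_mul, mul_assoc]
      rw [formsDeg, pow_one]
      refine add_mem (Submodule.mul_mem_mul ⟨v, rfl⟩ ?_) (Submodule.mul_mem_mul ⟨_, rfl⟩ hg)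
      exact mul_mem (S := Subalgebra ℂ (Forms lam)) ⟨x lam a, ofR3_x lam a⟩ hg
    | add p _ q _ hp hq => rw [mul_add]; exact add_mem hp hq
  | hC c =>
    intro ω h
    rw [AlgHom.commutes, ← Algebra.smul_def]
    exact Submodule.smul_mem _ _ h
  | hadd p q hp hq =>
    intro ω h
    rw [map_add, add_mul]
    exact add_mem (hp ω h) (hq ω h)
  | hmul p q hp hq =>
    intro ω h
    rw [map_mul, mul_assoc]
    exact hp _ (hq ω h)

theorem parity_ofR3 (lam : ℂ) (f : R3 lam) : parity lam (ofR3 lam f) = ofR3 lam f := by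
  induction f using R3.induct with
  | hX a => rw [ofR3_x, parity_X]
  | hC c => simp
  | hadd p q hp hq => simp [hp, hq]
  | hmul p q hp hq => simp [hp, hq]

theorem extD_ofR3_mem (lam : ℂ) (f : R3 lam) : extD lam (ofR3 lam f) ∈ formsDeg lam 1 := by
  induction f using R3.induct with
  | hX a =>
    rw [ofR3_x, extD_X, dCoord, formsDeg, pow_one, ← mul_one (formV lam _)]
    exact Submodule.smul_mem _ _
      (Submodule.mul_mem_mul ⟨_, rfl⟩ (one_mem (S := Subalgebra ℂ (Forms lam)) _))
  | hC c => rw [AlgHom.commutes, extD_algebraMap]; exact zero_mem _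
  | hadd p q hp hq => rw [map_add, map_add]; exact add_mem hp hq
  | hmul p q hp hq =>
    rw [map_mul, extD_mul, parity_ofR3]
    exact add_mem (formsDeg_one_mul_left lam p _ hq) (formsDeg_mul_right lam 1 hp q)

theorem extD_pow (lam : ℂ) (k : ℕ) :
    ∀ ω ∈ (LinearMap.range (formV lam)) ^ k, extD lam ω = 0 := by
  induction k with
  | zero =>
    intro ω h
    rw [pow_zero, Submodule.mem_one] at h
    obtain ⟨c, rfl⟩ := h
    exact extD_algebraMap lam c
  | succ k ih =>
    intro ω h
    rw [pow_succ] at h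
    induction h using Submodule.mul_induction_on' with
    | mem_mul_mem p hp v hv =>
      obtain ⟨v, rfl⟩ := hv
      rw [extD_mul, ih p hp, extD_V]; simp
    | add p _ q _ hp hq => rw [map_add, hp, hq, add_zero]

/-- The exterior derivative maps `Ω^k` to `Ω^(k+1)`. -/
theorem extD_mem (lam : ℂ) (k : ℕ) {ω : Forms lam} (h : ω ∈ formsDeg lam k) :
    extD lam ω ∈ formsDeg lam (k + 1) := by
  rw [formsDeg] at h
  induction h using Submodule.mul_induction_on' with
  | mem_mul_mem p hp g hg =>
    obtain ⟨f, rfl⟩ := hg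
    rw [extD_mul, extD_pow lam k p hp, zero_mul, add_zero, formsDeg, pow_succ, mul_assoc]
    refine Submodule.mul_mem_mul hp ?_
    have := extD_ofR3_mem lam f
    rwa [formsDeg, pow_one] at this
  | add p _ q _ hp hq => rw [map_add]; exact add_mem hp hq

theorem exactForms_le_closedForms (lam : ℂ) (k : ℕ) : exactForms lam k ≤ closedForms lam k := by
  cases k with
  | zero => exact bot_le
  | succ k =>
    rintro _ ⟨ω, hω, rfl⟩
    exact ⟨extD_mem lam k hω, extD_extD lam ω⟩

/-- The noncommutative de Rham cohomology `H^k` of `ℝ³_λ`: closed `k`-forms modulo exact ones. -/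
abbrev H (lam : ℂ) (k : ℕ) : Type :=
  closedForms lam k ⧸ (exactForms lam k).submoduleOf (closedForms lam k)

theorem one_mem_closedForms (lam : ℂ) : (1 : Forms lam) ∈ closedForms lam 0 := by
  refine ⟨?_, by simpa using extD_algebraMap lam 1⟩
  rw [formsDeg, pow_zero, one_mul]
  exact one_mem (ofR3 lam).range

/-- The class of the constant function `1` in `H^0`. -/
def oneClass (lam : ℂ) : H lam 0 :=
  Submodule.Quotient.mk ⟨1, one_mem_closedForms lam⟩

end R3Calculus

end

noncomputable section

namespace R3Calculus

/-! ### A monomial model of the coordinate algebra -/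

/-! Normal ordering, with powers of `x₂` and `x₃` on the left and functions of `x₁` on the right,
identifies `ℝ³_λ` as a vector space with polynomials in three variables. Moving one-forms to the
left gives `df = ∑ e_i ∂_i f` with commuting operators `∂_i`, and the complex becomes their Koszul
complex. The theorem is a Poincaré lemma for these operators.

Since `x₁ e₃ = e₃ (x₁ - λ)` and `dx₁ = -e₃`, the operator `∂₃` is minus the backward difference
quotient in `x₁` with step `λ`, while `∂₁` and `∂₂` are differentiation in `x₂` and `x₃` combined
with the shift `x₁ ↦ x₁ - λ`. Divided powers of `x₂`, `x₃` and rising factorials of `x₁` over `n!`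
are the basis in which differentiation and the difference quotient just lower an exponent. Then `∂₃`
is onto, `∂₂` is onto on `ker ∂₃`, `∂₁` is onto on `ker ∂₃ ∩ ker ∂₂`, and the common kernel is the
constants. This gives exactness in degrees one to three and `H⁰ = ℂ`.

Two independence facts make the reduction legitimate. Ordered monomials are independent in `ℝ³_λ`
(`toR3_injective`), because the algebra acts on the model. Coefficients of forms are well defined
(`oneForm_injective` and its analogues), because the forms act by matrices over `ℝ³_λ` (`formsMat`).
The differential is transported to the model by `extD_ofR3_toR3`, which rests on the twisted Leibniz
rule `pderiv_mulX`. -/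

/-- The space with basis indexed by `ℕ³`; the basis vector `(a, b, n)` stands for
`x₂^a x₃^b x₁(x₁+λ)⋯(x₁+(n-1)λ) / (a! b! n!)`. -/
abbrev Model : Type := (ℕ × ℕ × ℕ) →₀ ℂ

namespace Model

/-- The basis vectors of the model. -/
def mon (a b n : ℕ) : Model := Finsupp.single (a, b, n) 1

/-- The linear map with given values on the basis vectors. -/
def onBasis {M : Type} [AddCommGroup M] [Module ℂ M] (F : ℕ → ℕ → ℕ → M) : Model →ₗ[ℂ] M :=
  Finsupp.linearCombination ℂ fun k => F k.1 k.2.1 k.2.2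

@[simp]
theorem onBasis_mon {M : Type} [AddCommGroup M] [Module ℂ M] (F : ℕ → ℕ → ℕ → M) (a b n : ℕ) :
    onBasis F (mon a b n) = F a b n := by
  simp [onBasis, mon]

theorem hom_ext {M : Type} [AddCommGroup M] [Module ℂ M] {f g : Model →ₗ[ℂ] M}
    (h : ∀ a b n, f (mon a b n) = g (mon a b n)) : f = g := by
  apply Finsupp.lhom_ext'
  rintro ⟨a, b, n⟩
  apply LinearMap.ext_ring
  exact h a b n

/-- Left multiplication by the coordinates. -/
def mulX (lam : ℂ) : Fin 3 → Module.End ℂ Model :=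
  ![onBasis fun a b n =>
      -- Moving `x₁` past `x₂^a x₃^b` adds `2λ(a + b)`. Next to the rising factorial, `x₁ = (x₁ +
      -- nλ) - nλ`: the bracket extends the product, and the denominators `n!` and `(n+1)!` account
      -- for the factor `n + 1`.
      ((n : ℂ) + 1) • mon a b (n + 1) + (lam * (2 * (a + b) - n)) • mon a b n,
    onBasis fun a b n => ((a : ℂ) + 1) • mon (a + 1) b n,
    onBasis fun a b n => ((b : ℂ) + 1) • mon a (b + 1) n]

@[simp]
theorem mulX_zero_mon (lam : ℂ) (a b n : ℕ) : mulX lam 0 (mon a b n) =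
    ((n : ℂ) + 1) • mon a b (n + 1) + (lam * (2 * (a + b) - n)) • mon a b n := by
  simp [mulX]

@[simp]
theorem mulX_one_mon (lam : ℂ) (a b n : ℕ) :
    mulX lam 1 (mon a b n) = ((a : ℂ) + 1) • mon (a + 1) b n := by
  simp [mulX]

@[simp]
theorem mulX_two_mon (lam : ℂ) (a b n : ℕ) :
    mulX lam 2 (mon a b n) = ((b : ℂ) + 1) • mon a (b + 1) n := by
  simp [mulX]

theorem mulX_comm12 (lam : ℂ) : mulX lam 0 * mulX lam 1
    = mulX lam 1 * mulX lam 0 + (2 * lam) • mulX lam 1 := by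
  refine hom_ext fun a b n => ?_
  simp only [Module.End.mul_apply, LinearMap.add_apply, LinearMap.smul_apply, mulX_zero_mon,
    mulX_one_mon, map_add, map_smul]
  push_cast
  module

theorem mulX_comm13 (lam : ℂ) : mulX lam 0 * mulX lam 2
    = mulX lam 2 * mulX lam 0 + (2 * lam) • mulX lam 2 := by
  refine hom_ext fun a b n => ?_
  simp only [Module.End.mul_apply, LinearMap.add_apply, LinearMap.smul_apply, mulX_zero_mon,
    mulX_two_mon, map_add, map_smul]
  push_cast
  module

theorem mulX_comm23 (lam : ℂ) : mulX lam 1 * mulX lam 2 = mulX lam 2 * mulX lam 1 := by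
  refine hom_ext fun a b n => ?_
  simp only [Module.End.mul_apply, mulX_one_mon, mulX_two_mon, map_smul]
  module

/-- The action of `ℝ³_λ` on the model. -/
def action (lam : ℂ) : R3 lam →ₐ[ℂ] Module.End ℂ Model :=
  R3.lift lam (mulX lam) (mulX_comm12 lam) (mulX_comm13 lam) (mulX_comm23 lam)

theorem action_x (lam : ℂ) (a : Fin 3) : action lam (x lam a) = mulX lam a := R3.lift_x ..

/-- The model is generated by `mon 0 0 0` under the coordinates. -/
theorem eq_top_of_mulX_mem (lam : ℂ) {W : Submodule ℂ Model} (h0 : mon 0 0 0 ∈ W)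
    (hX : ∀ i, ∀ m ∈ W, mulX lam i m ∈ W) : W = ⊤ := by
  have key : ∀ (c : ℂ) (m : Model), c ≠ 0 → c • m ∈ W → m ∈ W := fun c m hc h =>
    (W.smul_mem_iff hc).1 h
  have hn : ∀ n, mon 0 0 n ∈ W := by
    intro n
    induction n with
    | zero => exact h0
    | succ n ih =>
      refine key ((n : ℂ) + 1) _ (Nat.cast_add_one_ne_zero n) ?_
      -- `x₁` sends `mon 0 0 n` to a nonzero multiple of `mon 0 0 (n + 1)` plus a multiple of `mon 0
      -- 0 n`, which already lies in `W`.
      have := hX 0 _ ih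
      rw [mulX_zero_mon] at this
      exact (W.add_mem_iff_left (W.smul_mem _ ih)).1 this
  have hb : ∀ b n, mon 0 b n ∈ W := by
    intro b n
    induction b with
    | zero => exact hn n
    | succ b ih => exact key ((b : ℂ) + 1) _ (Nat.cast_add_one_ne_zero b) (by simpa using hX 2 _ ih)
  have ha : ∀ a b n, mon a b n ∈ W := by
    intro a b n
    induction a with
    | zero => exact hb b n
    | succ a ih => exact key ((a : ℂ) + 1) _ (Nat.cast_add_one_ne_zero a) (by simpa using hX 1 _ ih)
  have hq : W.mkQ = 0 := hom_ext fun a b n => by simpa using ha a b n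
  rw [← W.ker_mkQ, hq, LinearMap.ker_zero]

end Model

/-! ### Normal ordering: the model is isomorphic to `ℝ³_λ`. -/

open Model

/-- The element `x₁(x₁+λ)⋯(x₁+(n-1)λ) / n!`. -/
def risingX (lam : ℂ) : ℕ → R3 lam
  | 0 => 1
  | n + 1 => ((n : ℂ) + 1)⁻¹ • ((x lam 0 + algebraMap ℂ _ (lam * n)) * risingX lam n)

/-- The element `x₂^a x₃^b x₁(x₁+λ)⋯(x₁+(n-1)λ) / (a! b! n!)`. -/
def monR3 (lam : ℂ) : ℕ → ℕ → ℕ → R3 lam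
  | 0, 0, n => risingX lam n
  | 0, b + 1, n => ((b : ℂ) + 1)⁻¹ • (x lam 2 * monR3 lam 0 b n)
  | a + 1, b, n => ((a : ℂ) + 1)⁻¹ • (x lam 1 * monR3 lam a b n)

theorem x_one_mul_monR3 (lam : ℂ) (a b n : ℕ) :
    x lam 1 * monR3 lam a b n = ((a : ℂ) + 1) • monR3 lam (a + 1) b n := by
  have : (a : ℂ) + 1 ≠ 0 := Nat.cast_add_one_ne_zero a
  rw [monR3, smul_inv_smul₀ this]

theorem x_two_mul_monR3 (lam : ℂ) (a b n : ℕ) :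
    x lam 2 * monR3 lam a b n = ((b : ℂ) + 1) • monR3 lam a (b + 1) n := by
  induction a with
  | zero =>
    have : (b : ℂ) + 1 ≠ 0 := Nat.cast_add_one_ne_zero b
    rw [monR3, smul_inv_smul₀ this]
  | succ a ih =>
    rw [monR3, mul_smul_comm, ← mul_assoc, ← x_comm23, mul_assoc, ih, monR3, mul_smul_comm,
      smul_comm]

theorem x_zero_mul_monR3 (lam : ℂ) (a b n : ℕ) :
    x lam 0 * monR3 lam a b n =
      ((n : ℂ) + 1) • monR3 lam a b (n + 1) + (lam * (2 * (a + b) - n)) • monR3 lam a b n := by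
  induction a with
  | zero =>
    induction b with
    | zero =>
      have : (n : ℂ) + 1 ≠ 0 := Nat.cast_add_one_ne_zero n
      simp only [monR3]
      rw [risingX, smul_inv_smul₀ this, add_mul, ← Algebra.smul_def]
      push_cast
      module
    | succ b ih =>
      rw [monR3, mul_smul_comm, ← mul_assoc, x_comm13, add_mul, mul_assoc, ih, monR3]
      simp only [mul_add, mul_smul_comm, smul_mul_assoc]
      push_cast
      module
  | succ a ih =>
    rw [monR3, mul_smul_comm, ← mul_assoc, x_comm12, add_mul, mul_assoc, ih, monR3]
    simp only [mul_add, mul_smul_comm, smul_mul_assoc]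
    push_cast
    module

/-- The linear map from the model to `ℝ³_λ`. -/
def toR3 (lam : ℂ) : Model →ₗ[ℂ] R3 lam := onBasis (monR3 lam)

theorem toR3_mulX (lam : ℂ) (i : Fin 3) (m : Model) :
    toR3 lam (mulX lam i m) = x lam i * toR3 lam m := by
  suffices h : toR3 lam ∘ₗ mulX lam i = LinearMap.mulLeft ℂ (x lam i) ∘ₗ toR3 lam from
    DFunLike.congr_fun h m
  refine hom_ext fun a b n => ?_
  fin_cases i
  · simpa [toR3] using (x_zero_mul_monR3 lam a b n).symm
  · simpa [toR3] using (x_one_mul_monR3 lam a b n).symm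
  · simpa [toR3] using (x_two_mul_monR3 lam a b n).symm

theorem toR3_mon_zero (lam : ℂ) : toR3 lam (mon 0 0 0) = 1 := by
  simp [toR3, monR3, risingX]

theorem toR3_action (lam : ℂ) (f : R3 lam) (m : Model) :
    toR3 lam (action lam f m) = f * toR3 lam m := by
  induction f using R3.induct generalizing m with
  | hX a => rw [action_x, toR3_mulX]
  | hC c => rw [AlgHom.commutes, ← Algebra.smul_def]; simp
  | hadd p q hp hq => simp [hp, hq, add_mul]
  | hmul p q hp hq => simp [hp, hq, mul_assoc]

theorem toR3_surjective (lam : ℂ) : Function.Surjective (toR3 lam) := fun f =>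
  ⟨action lam f (mon 0 0 0), by rw [toR3_action, toR3_mon_zero, mul_one]⟩

/-- This gives the independence of the ordered monomials, as in Poincaré–Birkhoff–Witt: they act on
`mon 0 0 0` by producing the basis vectors of the model. Both sides commute with the coordinates and
agree on the generator `mon 0 0 0`. -/
theorem action_toR3 (lam : ℂ) (m : Model) : action lam (toR3 lam m) (mon 0 0 0) = m := by
  let W : Submodule ℂ Model := LinearMap.eqLocus
    (LinearMap.applyₗ (mon 0 0 0) ∘ₗ (action lam).toLinearMap ∘ₗ toR3 lam) LinearMap.id
  have hW : W = ⊤ := by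
    apply eq_top_of_mulX_mem lam
    · show action lam (toR3 lam (mon 0 0 0)) (mon 0 0 0) = mon 0 0 0
      rw [toR3_mon_zero, map_one, Module.End.one_apply]
    · intro i m hm
      have hm' : action lam (toR3 lam m) (mon 0 0 0) = m := hm
      show action lam (toR3 lam (mulX lam i m)) (mon 0 0 0) = mulX lam i m
      rw [toR3_mulX, map_mul, Module.End.mul_apply, hm', action_x]
  have : m ∈ W := hW ▸ Submodule.mem_top
  exact this

theorem toR3_injective (lam : ℂ) : Function.Injective (toR3 lam) :=
  Function.LeftInverse.injective (g := fun f => action lam f (mon 0 0 0)) (action_toR3 lam)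

namespace Model

/-! ### Lowering and raising operators -/

/-- The operators that lower one of the three exponents. -/
def lower : Fin 3 → Module.End ℂ Model :=
  ![onBasis fun | 0, _, _ => 0 | a + 1, b, n => mon a b n,
    onBasis fun | _, 0, _ => 0 | a, b + 1, n => mon a b n,
    onBasis fun | _, _, 0 => 0 | a, b, n + 1 => mon a b n]

/-- The operators that raise one of the three exponents. -/
def raise : Fin 3 → Module.End ℂ Model :=
  ![onBasis fun a b n => mon (a + 1) b n,
    onBasis fun a b n => mon a (b + 1) n,
    onBasis fun a b n => mon a b (n + 1)]

section
variable (a b n : ℕ)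

@[simp] theorem lower_zero_mon_zero : lower 0 (mon 0 b n) = 0 := by simp [lower]
@[simp] theorem lower_zero_mon_succ : lower 0 (mon (a + 1) b n) = mon a b n := by simp [lower]
@[simp] theorem lower_one_mon_zero : lower 1 (mon a 0 n) = 0 := by simp [lower]
@[simp] theorem lower_one_mon_succ : lower 1 (mon a (b + 1) n) = mon a b n := by simp [lower]
@[simp] theorem lower_two_mon_zero : lower 2 (mon a b 0) = 0 := by simp [lower]
@[simp] theorem lower_two_mon_succ : lower 2 (mon a b (n + 1)) = mon a b n := by simp [lower]
@[simp] theorem raise_zero_mon : raise 0 (mon a b n) = mon (a + 1) b n := by simp [raise]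
@[simp] theorem raise_one_mon : raise 1 (mon a b n) = mon a (b + 1) n := by simp [raise]
@[simp] theorem raise_two_mon : raise 2 (mon a b n) = mon a b (n + 1) := by simp [raise]

end

theorem lower_raise (i : Fin 3) (m : Model) : lower i (raise i m) = m := by
  suffices h : lower i * raise i = 1 from DFunLike.congr_fun h m
  refine hom_ext fun a b n => ?_
  fin_cases i <;> simp

theorem lower_raise_of_ne {i j : Fin 3} (hij : i ≠ j) (m : Model) :
    lower i (raise j m) = raise j (lower i m) := by
  suffices h : lower i * raise j = raise j * lower i from DFunLike.congr_fun h m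
  refine hom_ext fun a b n => ?_
  fin_cases i <;> fin_cases j <;> first | exact absurd rfl hij | skip
  all_goals rcases a with _ | a <;> rcases b with _ | b <;> rcases n with _ | n <;> simp

theorem lower_comm (i j : Fin 3) (m : Model) : lower i (lower j m) = lower j (lower i m) := by
  suffices h : lower i * lower j = lower j * lower i from DFunLike.congr_fun h m
  refine hom_ext fun a b n => ?_
  fin_cases i <;> fin_cases j <;>
    rcases a with _ | a <;> rcases b with _ | b <;> rcases n with _ | n <;> simp

theorem mon_apply (a b n : ℕ) (k : ℕ × ℕ × ℕ) : mon a b n k = if (a, b, n) = k then 1 else 0 :=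
  Finsupp.single_apply

theorem lower_zero_apply (m : Model) (a b n : ℕ) : lower 0 m (a, b, n) = m (a + 1, b, n) := by
  suffices h : Finsupp.lapply (a, b, n) ∘ₗ lower 0 = Finsupp.lapply (R := ℂ) (a + 1, b, n) from
    DFunLike.congr_fun h m
  refine hom_ext fun a' b' n' => ?_
  rcases a' with _ | a' <;> simp [mon_apply]

theorem lower_one_apply (m : Model) (a b n : ℕ) : lower 1 m (a, b, n) = m (a, b + 1, n) := by
  suffices h : Finsupp.lapply (a, b, n) ∘ₗ lower 1 = Finsupp.lapply (R := ℂ) (a, b + 1, n) from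
    DFunLike.congr_fun h m
  refine hom_ext fun a' b' n' => ?_
  rcases b' with _ | b' <;> simp [mon_apply]

theorem lower_two_apply (m : Model) (a b n : ℕ) : lower 2 m (a, b, n) = m (a, b, n + 1) := by
  suffices h : Finsupp.lapply (a, b, n) ∘ₗ lower 2 = Finsupp.lapply (R := ℂ) (a, b, n + 1) from
    DFunLike.congr_fun h m
  refine hom_ext fun a' b' n' => ?_
  rcases n' with _ | n' <;> simp [mon_apply]

theorem eq_smul_mon_of_lower_eq_zero {m : Model} (h : ∀ i, lower i m = 0) :
    m = m (0, 0, 0) • mon 0 0 0 := by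
  ext ⟨a, b, n⟩
  rcases a with _ | a
  · rcases b with _ | b
    · rcases n with _ | n
      · simp [mon]
      · rw [← lower_two_apply m 0 0 n, h]; simp [mon]
    · rw [← lower_one_apply m 0 b n, h]; simp [mon]
  · rw [← lower_zero_apply m a b n, h]; simp [mon]

/-! ### Partial derivatives and their twisted Leibniz rule. -/

/-- The partial derivatives: the components of `d` in the basis of one-forms. -/
def pderiv (lam : ℂ) : Fin 3 → Module.End ℂ Model :=
  -- On rising factorials over `n!`, `lower 2` is `f ↦ (f(x₁) - f(x₁ - λ))/λ`, so `1 - λ • lower 2`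
  -- is the shift `x₁ ↦ x₁ - λ`. The last sign comes from `dx₁ = -e₃`.
  ![lower 0 * (1 - lam • lower 2), lower 1 * (1 - lam • lower 2), -lower 2]

theorem pderiv_zero_apply (lam : ℂ) (m : Model) :
    pderiv lam 0 m = lower 0 m - lam • lower 0 (lower 2 m) := by
  simp [pderiv]

theorem pderiv_one_apply (lam : ℂ) (m : Model) :
    pderiv lam 1 m = lower 1 m - lam • lower 1 (lower 2 m) := by
  simp [pderiv]

theorem pderiv_two_apply (lam : ℂ) (m : Model) : pderiv lam 2 m = -lower 2 m := by
  simp [pderiv]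

theorem pderiv_comm (lam : ℂ) (i j : Fin 3) (m : Model) :
    pderiv lam i (pderiv lam j m) = pderiv lam j (pderiv lam i m) := by
  fin_cases i <;> fin_cases j <;>
    simp [pderiv, lower_comm 1 0, lower_comm 2 0, lower_comm 2 1]
  all_goals abel

theorem pderiv_mon_zero (lam : ℂ) (i : Fin 3) : pderiv lam i (mon 0 0 0) = 0 := by
  fin_cases i <;> simp [pderiv]

/-- The twisted Leibniz rule for the partial derivatives. -/
theorem pderiv_mulX {lam : ℂ} (hlam : lam ≠ 0) (i a : Fin 3) (m : Model) :
    pderiv lam i (mulX lam a m) = mulX lam a (pderiv lam i m)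
      + ∑ j, repMat lam a i j • pderiv lam j m + (lam⁻¹ * repMat lam a i 2) • m := by
  -- This is the `e_i`-component of `d(x_a f) = x_a df + dx_a f`: the sum arises from moving `x_a`
  -- past the one-forms in `df`, and the last term from `dx_a = λ⁻¹ ρ(x_a) e₃`.
  suffices h : pderiv lam i * mulX lam a = mulX lam a * pderiv lam i
      + ∑ j, repMat lam a i j • pderiv lam j + (lam⁻¹ * repMat lam a i 2) • 1 by
    simpa using DFunLike.congr_fun h m
  refine hom_ext fun p q n => ?_
  fin_cases i <;> fin_cases a <;> rcases p with _ | p <;> rcases q with _ | q <;>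
    rcases n with _ | n <;>
    simp [Fin.sum_univ_three, repMat, pderiv_zero_apply, pderiv_one_apply, pderiv_two_apply, hlam]
  all_goals module

/-! ### Poincaré lemma for the commuting operators `pderiv`. -/

theorem exists_pderiv_two (lam : ℂ) (m : Model) : ∃ p, pderiv lam 2 p = m :=
  ⟨-raise 2 m, by simp [pderiv_two_apply, lower_raise]⟩

/-- On the kernel of `pderiv lam 2` the shift in `x₁` is the identity, so `pderiv lam 1` reduces to
`lower 1`. Its right inverse `raise 1` preserves that kernel. -/
theorem exists_pderiv_one (lam : ℂ) {m : Model} (h2 : pderiv lam 2 m = 0) :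
    ∃ p, pderiv lam 2 p = 0 ∧ pderiv lam 1 p = m := by
  simp only [pderiv_two_apply, neg_eq_zero] at h2
  have h : lower 2 (raise 1 m) = 0 := by rw [lower_raise_of_ne (by decide), h2, map_zero]
  exact ⟨raise 1 m, by simp [pderiv_two_apply, h], by simp [pderiv_one_apply, h, lower_raise]⟩

theorem exists_pderiv_zero (lam : ℂ) {m : Model} (h2 : pderiv lam 2 m = 0)
    (h1 : pderiv lam 1 m = 0) :
    ∃ p, pderiv lam 2 p = 0 ∧ pderiv lam 1 p = 0 ∧ pderiv lam 0 p = m := by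
  simp only [pderiv_two_apply, neg_eq_zero] at h2
  simp only [pderiv_one_apply, h2, map_zero, smul_zero, sub_zero] at h1
  have h : lower 2 (raise 0 m) = 0 := by rw [lower_raise_of_ne (by decide), h2, map_zero]
  have h' : lower 1 (raise 0 m) = 0 := by rw [lower_raise_of_ne (by decide), h1, map_zero]
  exact ⟨raise 0 m, by simp [pderiv_two_apply, h], by simp [pderiv_one_apply, h, h'],
    by simp [pderiv_zero_apply, h, lower_raise]⟩

/-- Exactness in degree zero. -/
theorem eq_smul_mon_of_pderiv_eq_zero {lam : ℂ} {m : Model} (h : ∀ i, pderiv lam i m = 0) :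
    m = m (0, 0, 0) • mon 0 0 0 := by
  have h0 := h 0
  have h1 := h 1
  have h2 := h 2
  simp only [pderiv_two_apply, neg_eq_zero] at h2
  simp only [pderiv_zero_apply, pderiv_one_apply, h2, map_zero, smul_zero, sub_zero] at h0 h1
  exact eq_smul_mon_of_lower_eq_zero (Fin.forall_fin_succ.2 ⟨h0, Fin.forall_fin_two.2 ⟨h1, h2⟩⟩)

/-- Exactness in degree one. -/
theorem exists_of_pderiv_symm {lam : ℂ} {a : Fin 3 → Model}
    (h : ∀ i j, pderiv lam i (a j) = pderiv lam j (a i)) : ∃ f, ∀ i, pderiv lam i f = a i := by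
  -- The system is integrated one variable at a time, starting from the last. By symmetry each
  -- remainder is killed by the derivatives already treated, so it can be integrated without
  -- spoiling the equations already solved.
  obtain ⟨f, hf⟩ := exists_pderiv_two lam (a 2)
  obtain ⟨g, hg2, hg1⟩ := exists_pderiv_one lam (m := a 1 - pderiv lam 1 f)
    (by rw [map_sub, pderiv_comm, hf, h, sub_self])
  obtain ⟨k, hk2, hk1, hk0⟩ := exists_pderiv_zero lam (m := a 0 - pderiv lam 0 f - pderiv lam 0 g)
    (by rw [map_sub, map_sub, pderiv_comm, hf, h, pderiv_comm lam 2 0 g, hg2]; simp)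
    (by rw [map_sub, map_sub, pderiv_comm, pderiv_comm lam 1 0 g, hg1, h, map_sub]; simp)
  refine ⟨f + g + k, Fin.forall_fin_succ.2 ⟨?_, Fin.forall_fin_two.2 ⟨?_, ?_⟩⟩⟩
  · simp [hk0]
  · simp [hg1, hk1]
  · simp [hf, hg2, hk2]

/-- Exactness in degree two. -/
theorem exists_of_pderiv_add_eq_zero {lam : ℂ} {a b c : Model}
    (h : pderiv lam 2 a - pderiv lam 1 b + pderiv lam 0 c = 0) :
    ∃ f : Fin 3 → Model, pderiv lam 1 (f 0) - pderiv lam 0 (f 1) = a ∧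
      pderiv lam 2 (f 0) - pderiv lam 0 (f 2) = b ∧
      pderiv lam 2 (f 1) - pderiv lam 1 (f 2) = c := by
  -- `f` and `g` solve the last two equations with third component `0`. By `h` the error in the
  -- first equation is killed by `pderiv lam 2`, so it is removed by some `k` in the same kernel,
  -- which leaves the other two equations intact.
  obtain ⟨f, hf⟩ := exists_pderiv_two lam b
  obtain ⟨g, hg⟩ := exists_pderiv_two lam c
  obtain ⟨k, hk2, hk1⟩ := exists_pderiv_one lam (m := a - (pderiv lam 1 f - pderiv lam 0 g))
    (by rw [map_sub, map_sub, pderiv_comm lam 2 1, pderiv_comm lam 2 0, hf, hg, ← h]; abel)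
  refine ⟨![f + k, g, 0], ?_, ?_, ?_⟩
  · simp only [Matrix.cons_val_zero, Matrix.cons_val_one, map_add, hk1]
    abel
  · simp [hf, hk2]
  · simp [hg]

end Model

/-! ### A faithful representation of the forms

The exterior algebra on `e₁, e₂, e₃` has the basis
`1, e₁, e₂, e₃, e₁e₂, e₁e₃, e₂e₃, e₁e₂e₃`, indexed by `Fin 8`. -/

/-- Left multiplication by `e_i` on the exterior algebra. -/
def wedgeMat : Fin 3 → Matrix (Fin 8) (Fin 8) ℤ :=
  ![Matrix.of fun i j => if (i, j) ∈ [(1, 0), (4, 2), (5, 3), (7, 6)] then 1 else 0,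
    Matrix.of fun i j => if (i, j) ∈ [(2, 0), (6, 3)] then 1 else
      if (i, j) ∈ [(4, 1), (7, 5)] then -1 else 0,
    Matrix.of fun i j => if (i, j) ∈ [(3, 0), (7, 4)] then 1 else
      if (i, j) ∈ [(5, 1), (6, 2)] then -1 else 0]

/-- The derivation of the exterior algebra that extends `λ⁻¹ ρ(x_a)`. -/
def derMat : Fin 3 → Matrix (Fin 8) (Fin 8) ℤ :=
  ![Matrix.diagonal ![0, 1, 1, -1, 2, 0, 0, 1],
    Matrix.of fun i j => if (i, j) = (1, 3) then 1 else if (i, j) = (4, 6) then -1 else 0,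
    Matrix.of fun i j => if (i, j) ∈ [(2, 3), (4, 5)] then 1 else 0]

/-- The matrices `λ⁻¹ ρ(x_a)`. -/
def repMatInt : Fin 3 → Matrix (Fin 3) (Fin 3) ℤ :=
  ![!![1, 0, 0; 0, 1, 0; 0, 0, -1], !![0, 0, 1; 0, 0, 0; 0, 0, 0],
    !![0, 0, 0; 0, 0, 1; 0, 0, 0]]

theorem repMat_eq (lam : ℂ) (a i j : Fin 3) : repMat lam a i j = lam * repMatInt a i j := by
  fin_cases a <;> fin_cases i <;> fin_cases j <;> simp [repMat, repMatInt]

/-- With integer entries and `λ` factored out, this and the next matrix identities are finite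
computations. The factor `λ` returns in `coordMat`. -/
theorem wedgeMat_mul (i j : Fin 3) : wedgeMat i * wedgeMat j = -(wedgeMat j * wedgeMat i) := by
  decide +revert +kernel

theorem derMat_mul_wedgeMat (a i : Fin 3) : derMat a * wedgeMat i =
    wedgeMat i * derMat a + ∑ j, repMatInt a j i • wedgeMat j := by
  decide +revert +kernel

theorem derMat_comm12 : derMat 0 * derMat 1 = derMat 1 * derMat 0 + 2 • derMat 1 := by
  decide +kernel

theorem derMat_comm13 : derMat 0 * derMat 2 = derMat 2 * derMat 0 + 2 • derMat 2 := by
  decide +kernel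

theorem derMat_comm23 : derMat 1 * derMat 2 = derMat 2 * derMat 1 := by
  decide +kernel

/-- Integer matrices as matrices over `ℝ³_λ`. -/
def castMat (lam : ℂ) : Matrix (Fin 8) (Fin 8) ℤ →+* Matrix (Fin 8) (Fin 8) (R3 lam) :=
  (Int.castRingHom (R3 lam)).mapMatrix

@[simp]
theorem castMat_apply (lam : ℂ) (M : Matrix (Fin 8) (Fin 8) ℤ) (i j : Fin 8) :
    castMat lam M i j = (M i j : R3 lam) := rfl

theorem scalar_mul_castMat (lam : ℂ) (f : R3 lam) (M : Matrix (Fin 8) (Fin 8) ℤ) :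
    Matrix.scalar (Fin 8) f * castMat lam M = castMat lam M * Matrix.scalar (Fin 8) f := by
  ext i j
  simp [Matrix.scalar_apply, (Int.cast_commute (M i j) f).eq]

/-- The matrix of left multiplication by the coordinate `x_a` on the right `ℝ³_λ`-module of
forms. -/
def coordMat (lam : ℂ) (a : Fin 3) : Matrix (Fin 8) (Fin 8) (R3 lam) :=
  -- For an exterior monomial `e_I`, `x_a e_I f = e_I x_a f + λ D_a(e_I) f`, where `D_a` is the
  -- derivation extending `λ⁻¹ ρ(x_a)`.
  Matrix.scalar (Fin 8) (x lam a) + lam • castMat lam (derMat a)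

/-- The scalar part and the derivation part commute with each other, so their commutation relations
add up. The integer `c` covers all three relations, with values `2`, `2` and `0`. -/
theorem coordMat_comm (lam : ℂ) {a b : Fin 3} {c : ℤ}
    (hx : x lam a * x lam b = x lam b * x lam a + (c * lam) • x lam b)
    (hd : derMat a * derMat b = derMat b * derMat a + c • derMat b) :
    coordMat lam a * coordMat lam b
      = coordMat lam b * coordMat lam a + (c * lam) • coordMat lam b := by
  have hx' := congrArg (Matrix.scalar (Fin 8)) hx
  have hd' := congrArg (castMat lam) hd
  have hs : Matrix.scalar (Fin 8) ((c * lam) • x lam b)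
      = (c * lam) • Matrix.scalar (Fin 8) (x lam b) := by
    ext i j; simp [Matrix.scalar_apply, Matrix.diagonal_apply]
  simp only [map_mul, map_add, hs] at hx'
  simp only [map_mul, map_add, map_zsmul] at hd'
  simp only [coordMat, mul_add, add_mul, hx', mul_smul_comm, smul_mul_assoc, hd',
    scalar_mul_castMat, smul_add, ← Int.cast_smul_eq_zsmul ℂ c, smul_smul]
  rw [mul_comm (c : ℂ) lam]
  module

/-- The matrix of left multiplication by the one-form `v`. -/
def vecMat (lam : ℂ) : (Fin 3 → ℂ) →ₗ[ℂ] Matrix (Fin 8) (Fin 8) (R3 lam) :=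
  Fintype.linearCombination ℂ fun i => castMat lam (wedgeMat i)

theorem vecMat_apply (lam : ℂ) (v : Fin 3 → ℂ) :
    vecMat lam v = ∑ i, v i • castMat lam (wedgeMat i) :=
  Fintype.linearCombination_apply ..

theorem coordMat_mul_vecMat (lam : ℂ) (a : Fin 3) (v : Fin 3 → ℂ) :
    coordMat lam a * vecMat lam v = vecMat lam v * coordMat lam a
      + vecMat lam ((rho lam (x lam a)).mulVec v) := by
  have h : ∀ i, coordMat lam a * castMat lam (wedgeMat i) =
      castMat lam (wedgeMat i) * coordMat lam a
        + ∑ j, repMat lam a j i • castMat lam (wedgeMat j) := by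
    intro i
    have := congrArg (castMat lam) (derMat_mul_wedgeMat a i)
    simp only [map_mul, map_add, map_sum, map_zsmul] at this
    simp only [coordMat, add_mul, mul_add, scalar_mul_castMat, smul_mul_assoc, mul_smul_comm, this,
      smul_add, Finset.smul_sum, repMat_eq, mul_smul, Int.cast_smul_eq_zsmul, add_assoc]
  simp only [vecMat_apply, Finset.mul_sum, Finset.sum_mul, mul_smul_comm, smul_mul_assoc, h,
    smul_add, Finset.sum_add_distrib, rho_x, Matrix.mulVec, dotProduct, Finset.sum_smul,
    Finset.smul_sum, smul_smul]
  rw [Finset.sum_comm (s := Finset.univ)]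
  simp only [mul_comm]

theorem vecMat_mul (lam : ℂ) (v w : Fin 3 → ℂ) :
    vecMat lam v * vecMat lam w = -(vecMat lam w * vecMat lam v) := by
  simp only [vecMat_apply, Finset.mul_sum, Finset.sum_mul, mul_smul_comm, smul_mul_assoc,
    ← map_mul, Finset.smul_sum]
  rw [Finset.sum_comm, ← Finset.sum_neg_distrib]
  refine Finset.sum_congr rfl fun j _ => ?_
  rw [← Finset.sum_neg_distrib]
  refine Finset.sum_congr rfl fun i _ => ?_
  rw [wedgeMat_mul, map_neg, smul_neg, smul_neg, smul_comm]

/-- The representation of the forms by matrices over `ℝ³_λ`. -/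
def formsMat (lam : ℂ) : Forms lam →ₐ[ℂ] Matrix (Fin 8) (Fin 8) (R3 lam) :=
  Forms.lift lam (coordMat lam) (vecMat lam)
    (by
      simpa using coordMat_comm lam (c := 2) (by simpa using x_comm12 lam)
        (by simpa using derMat_comm12))
    (by
      simpa using coordMat_comm lam (c := 2) (by simpa using x_comm13 lam)
        (by simpa using derMat_comm13))
    (by
      simpa using coordMat_comm lam (c := 0) (by simpa using x_comm23 lam)
        (by simpa using derMat_comm23))
    (coordMat_mul_vecMat lam) (vecMat_mul lam)

/-- The basic one-form `e_i`. -/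
def formE (lam : ℂ) (i : Fin 3) : Forms lam := formV lam (basisVec i)

theorem formsMat_formX (lam : ℂ) (a : Fin 3) : formsMat lam (formX lam a) = coordMat lam a :=
  Forms.lift_X ..

theorem formsMat_formE (lam : ℂ) (i : Fin 3) :
    formsMat lam (formE lam i) = castMat lam (wedgeMat i) := by
  rw [formE, formsMat, Forms.lift_V, vecMat_apply]
  simp [basisVec, Pi.single_apply]

theorem derMat_apply_zero (a : Fin 3) (i : Fin 8) : derMat a i 0 = 0 := by
  decide +revert +kernel

/-- Column `0` is the result of acting on `1`, so it records the coefficients of a form. The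
derivations kill `1`, hence a zero-form contributes only itself. -/
theorem formsMat_ofR3 (lam : ℂ) (f : R3 lam) (i : Fin 8) :
    formsMat lam (ofR3 lam f) i 0 = if i = 0 then f else 0 := by
  induction f using R3.induct generalizing i with
  | hX a =>
    rw [ofR3_x, formsMat_formX, coordMat, Matrix.add_apply, Matrix.smul_apply, castMat_apply,
      derMat_apply_zero, Matrix.scalar_apply, Matrix.diagonal_apply]
    by_cases h : i = 0 <;> simp [h]
  | hC c => simp [Matrix.algebraMap_matrix_apply]
  | hadd p q hp hq => rw [map_add, map_add, Matrix.add_apply, hp, hq]; split_ifs <;> simp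
  | hmul p q hp hq =>
    rw [map_mul, map_mul, Matrix.mul_apply]
    simp [hq, hp]

theorem formsMat_mul_ofR3 (lam : ℂ) (ω : Forms lam) (f : R3 lam) (i : Fin 8) :
    formsMat lam (ω * ofR3 lam f) i 0 = formsMat lam ω i 0 * f := by
  rw [map_mul, Matrix.mul_apply]
  simp [formsMat_ofR3]

theorem formE_mul_self (lam : ℂ) (i : Fin 3) : formE lam i * formE lam i = 0 := by
  -- For equal indices anticommutation only says that twice the square vanishes.
  have h : (2 : ℂ) • (formE lam i * formE lam i) = 0 := by
    rw [two_smul]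
    nth_rewrite 1 [formE, formE, formV_wedge]
    exact neg_add_cancel _
  exact (smul_eq_zero.1 h).resolve_left two_ne_zero

theorem formE_mul_swap (lam : ℂ) (i j : Fin 3) :
    formE lam i * formE lam j = -(formE lam j * formE lam i) := formV_wedge ..

theorem formV_eq_sum (lam : ℂ) (v : Fin 3 → ℂ) : formV lam v = ∑ i, v i • formE lam i := by
  conv_lhs => rw [vec_eq_sum v]
  simp [formE]

/-! ### Forms with coefficients -/

/-- The one-form `∑ e_i f_i`. -/
def oneForm (lam : ℂ) (f : Fin 3 → R3 lam) : Forms lam := ∑ i, formE lam i * ofR3 lam (f i)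

/-- The two-form `e₁ e₂ f + e₁ e₃ g + e₂ e₃ h`. -/
def twoForm (lam : ℂ) (f g h : R3 lam) : Forms lam :=
  formE lam 0 * (formE lam 1 * ofR3 lam f) + formE lam 0 * (formE lam 2 * ofR3 lam g)
    + formE lam 1 * (formE lam 2 * ofR3 lam h)

/-- The three-form `e₁ e₂ e₃ f`. -/
def threeForm (lam : ℂ) (f : R3 lam) : Forms lam :=
  formE lam 0 * (formE lam 1 * (formE lam 2 * ofR3 lam f))

/-! ### Uniqueness and existence of coefficients in each degree. -/

theorem oneForm_injective (lam : ℂ) : Function.Injective (oneForm lam) := by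
  intro f g h
  have key : ∀ f : Fin 3 → R3 lam, formsMat lam (oneForm lam f) 1 0 = f 0 ∧
      formsMat lam (oneForm lam f) 2 0 = f 1 ∧ formsMat lam (oneForm lam f) 3 0 = f 2 := by
    intro f
    simp only [oneForm, Fin.sum_univ_three, map_add, Matrix.add_apply, formsMat_mul_ofR3,
      formsMat_formE, castMat_apply]
    simp [wedgeMat]
  have h0 := (key f).1
  have h1 := (key f).2.1
  have h2 := (key f).2.2
  rw [h] at h0 h1 h2
  funext i
  fin_cases i
  · exact h0.symm.trans (key g).1
  · exact h1.symm.trans (key g).2.1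
  · exact h2.symm.trans (key g).2.2

theorem eq_zero_of_twoForm_eq_zero (lam : ℂ) {f g h : R3 lam} (H : twoForm lam f g h = 0) :
    f = 0 ∧ g = 0 ∧ h = 0 := by
  have key : formsMat lam (twoForm lam f g h) 4 0 = f ∧
      formsMat lam (twoForm lam f g h) 5 0 = g ∧ formsMat lam (twoForm lam f g h) 6 0 = h := by
    simp only [twoForm, map_add, Matrix.add_apply, ← mul_assoc, formsMat_mul_ofR3]
    simp only [map_mul (formsMat lam) (formE lam _), formsMat_formE, ← map_mul, castMat_apply]
    have hw : ∀ k ∈ ([4, 5, 6] : List (Fin 8)),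
        (wedgeMat 0 * wedgeMat 1) k 0 = (if k = 4 then 1 else 0) ∧
        (wedgeMat 0 * wedgeMat 2) k 0 = (if k = 5 then 1 else 0) ∧
        (wedgeMat 1 * wedgeMat 2) k 0 = (if k = 6 then 1 else 0) := by decide +kernel
    simp [hw]
  rw [H] at key
  simpa [eq_comm] using key

theorem eq_zero_of_threeForm_eq_zero (lam : ℂ) {f : R3 lam} (h : threeForm lam f = 0) :
    f = 0 := by
  have key : formsMat lam (threeForm lam f) 7 0 = f := by
    simp only [threeForm, ← mul_assoc, formsMat_mul_ofR3]
    simp only [map_mul (formsMat lam), formsMat_formE]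
    simp only [← map_mul, castMat_apply]
    rw [show (wedgeMat 0 * wedgeMat 1 * wedgeMat 2) 7 0 = 1 by decide +kernel]
    simp
  rw [h] at key
  simpa using key.symm

theorem mul_oneForm (lam : ℂ) (v : Fin 3 → ℂ) (f : Fin 3 → R3 lam) :
    formV lam v * oneForm lam f =
      twoForm lam (v 0 • f 1 - v 1 • f 0) (v 0 • f 2 - v 2 • f 0) (v 1 • f 2 - v 2 • f 1) := by
  have h (i : Fin 3) (p : Forms lam) : formE lam i * (formE lam i * p) = 0 := by
    rw [← mul_assoc, formE_mul_self, zero_mul]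
  have h' (i j : Fin 3) (p : Forms lam) :
      formE lam i * (formE lam j * p) = -(formE lam j * (formE lam i * p)) := by
    rw [← mul_assoc, formE_mul_swap, neg_mul, mul_assoc]
  simp only [formV_eq_sum, oneForm, twoForm, Fin.sum_univ_three, mul_add, add_mul, smul_mul_assoc,
    h, h' 1 0, h' 2 0, h' 2 1, map_sub, map_smul, mul_sub, mul_smul_comm]
  module

theorem mul_twoForm (lam : ℂ) (v : Fin 3 → ℂ) (f g h : R3 lam) :
    formV lam v * twoForm lam f g h = threeForm lam (v 2 • f - v 1 • g + v 0 • h) := by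
  have H (i : Fin 3) (p : Forms lam) : formE lam i * (formE lam i * p) = 0 := by
    rw [← mul_assoc, formE_mul_self, zero_mul]
  have H' (i j : Fin 3) (p : Forms lam) :
      formE lam i * (formE lam j * p) = -(formE lam j * (formE lam i * p)) := by
    rw [← mul_assoc, formE_mul_swap, neg_mul, mul_assoc]
  simp only [formV_eq_sum, twoForm, threeForm, Fin.sum_univ_three, mul_add, add_mul,
    smul_mul_assoc, H, H' 1 0, H' 2 0, H' 2 1, map_sub, map_add, map_smul, mul_sub, mul_smul_comm,
    mul_neg, mul_zero]
  module

theorem mem_formsDeg_zero (lam : ℂ) {ω : Forms lam} :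
    ω ∈ formsDeg lam 0 ↔ ∃ f, ofR3 lam f = ω := by
  rw [formsDeg, pow_zero, one_mul]
  rfl

theorem formsDeg_succ (lam : ℂ) (k : ℕ) :
    formsDeg lam (k + 1) = LinearMap.range (formV lam) * formsDeg lam k := by
  rw [formsDeg, formsDeg, pow_succ', mul_assoc]

theorem exists_oneForm (lam : ℂ) {ω : Forms lam} (h : ω ∈ formsDeg lam 1) :
    ∃ f, oneForm lam f = ω := by
  rw [formsDeg_succ] at h
  induction h using Submodule.mul_induction_on' with
  | mem_mul_mem v hv p hp =>
    obtain ⟨v, rfl⟩ := hv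
    obtain ⟨f, rfl⟩ := (mem_formsDeg_zero lam).1 hp
    exact ⟨fun i => v i • f, by simp [oneForm, formV_eq_sum, Finset.sum_mul]⟩
  | add p _ q _ hp hq =>
    obtain ⟨f, rfl⟩ := hp
    obtain ⟨g, rfl⟩ := hq
    exact ⟨f + g, by simp [oneForm, mul_add, Finset.sum_add_distrib]⟩

theorem exists_twoForm (lam : ℂ) {ω : Forms lam} (h : ω ∈ formsDeg lam 2) :
    ∃ f g h, twoForm lam f g h = ω := by
  rw [formsDeg_succ] at h
  induction h using Submodule.mul_induction_on' with
  | mem_mul_mem v hv p hp =>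
    obtain ⟨v, rfl⟩ := hv
    obtain ⟨f, rfl⟩ := exists_oneForm lam hp
    exact ⟨_, _, _, (mul_oneForm lam v f).symm⟩
  | add p _ q _ hp hq =>
    obtain ⟨f, g, h, rfl⟩ := hp
    obtain ⟨f', g', h', rfl⟩ := hq
    exact ⟨f + f', g + g', h + h', by simp only [twoForm, map_add, mul_add]; abel⟩

theorem exists_threeForm (lam : ℂ) {ω : Forms lam} (h : ω ∈ formsDeg lam 3) :
    ∃ f, threeForm lam f = ω := by
  rw [formsDeg_succ] at h
  induction h using Submodule.mul_induction_on' with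
  | mem_mul_mem v hv p hp =>
    obtain ⟨v, rfl⟩ := hv
    obtain ⟨f, g, h, rfl⟩ := exists_twoForm lam hp
    exact ⟨_, (mul_twoForm lam v f g h).symm⟩
  | add p _ q _ hp hq =>
    obtain ⟨f, rfl⟩ := hp
    obtain ⟨g, rfl⟩ := hq
    exact ⟨f + g, by simp only [threeForm, map_add, mul_add]⟩

theorem formE_mul_mem (lam : ℂ) (i : Fin 3) {k : ℕ} {ω : Forms lam} (h : ω ∈ formsDeg lam k) :
    formE lam i * ω ∈ formsDeg lam (k + 1) := by
  rw [formsDeg_succ]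
  exact Submodule.mul_mem_mul ⟨_, rfl⟩ h

theorem ofR3_mem (lam : ℂ) (f : R3 lam) : ofR3 lam f ∈ formsDeg lam 0 :=
  (mem_formsDeg_zero lam).2 ⟨f, rfl⟩

theorem oneForm_mem (lam : ℂ) (f : Fin 3 → R3 lam) : oneForm lam f ∈ formsDeg lam 1 :=
  Submodule.sum_mem _ fun i _ => formE_mul_mem lam i (ofR3_mem lam (f i))

theorem twoForm_mem (lam : ℂ) (f g h : R3 lam) : twoForm lam f g h ∈ formsDeg lam 2 :=
  add_mem (add_mem (formE_mul_mem lam 0 (formE_mul_mem lam 1 (ofR3_mem lam f)))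
    (formE_mul_mem lam 0 (formE_mul_mem lam 2 (ofR3_mem lam g))))
    (formE_mul_mem lam 1 (formE_mul_mem lam 2 (ofR3_mem lam h)))

/-- The right-handed Leibniz rule puts its sign on the term with `de_i = 0`, so none survives here.
-/
theorem extD_formE_mul (lam : ℂ) (i : Fin 3) (ω : Forms lam) :
    extD lam (formE lam i * ω) = formE lam i * extD lam ω := by
  rw [extD_mul, formE, extD_V, zero_mul, add_zero]

/-! ### The differential in the model -/

theorem formX_mul_oneForm (lam : ℂ) (a : Fin 3) (f : Fin 3 → R3 lam) :
    formX lam a * oneForm lam f =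
      oneForm lam fun i => x lam a * f i + ∑ j, repMat lam a i j • f j := by
  have h : ∀ j, formX lam a * formE lam j =
      formE lam j * formX lam a + ∑ i, repMat lam a i j • formE lam i := by
    intro j
    rw [formE, formX_bimod, formV_eq_sum lam (Matrix.mulVec _ _), rho_x]
    simp [Matrix.mulVec, dotProduct, basisVec, Pi.single_apply]
  simp only [oneForm, Finset.mul_sum, ← mul_assoc, h, add_mul, Finset.sum_mul, map_add, map_mul,
    map_sum, map_smul, mul_add, ofR3_x, smul_mul_assoc, mul_smul_comm, Finset.sum_add_distrib]
  rw [Finset.sum_comm (s := Finset.univ)]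

theorem dCoord_mul_ofR3 (lam : ℂ) (a : Fin 3) (f : R3 lam) :
    dCoord lam a * ofR3 lam f = oneForm lam fun i => (lam⁻¹ * repMat lam a i 2) • f := by
  rw [dCoord, formV_eq_sum]
  simp [rhoLambda, rho_x, bigLambda, basisVec, oneForm, Finset.sum_mul, Finset.smul_sum, smul_smul]

theorem oneForm_add (lam : ℂ) (f g : Fin 3 → R3 lam) :
    oneForm lam f + oneForm lam g = oneForm lam fun i => f i + g i := by
  simp [oneForm, mul_add, Finset.sum_add_distrib]

/-- Both sides are linear in `m`, vanish on the constant `1`, and obey the same twisted Leibniz rule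
under left multiplication by each `x_a`. Since the coordinates generate the model from `mon 0 0 0`,
they agree. -/
theorem extD_ofR3_toR3 {lam : ℂ} (hlam : lam ≠ 0) (m : Model) :
    extD lam (ofR3 lam (toR3 lam m)) = oneForm lam fun i => toR3 lam (pderiv lam i m) := by
  let W : Submodule ℂ Model := LinearMap.eqLocus
    (extD lam ∘ₗ (ofR3 lam).toLinearMap ∘ₗ toR3 lam)
    (∑ i, LinearMap.mulLeft ℂ (formE lam i) ∘ₗ (ofR3 lam).toLinearMap ∘ₗ toR3 lam ∘ₗ pderiv lam i)
  have hmem : ∀ m, m ∈ W ↔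
      extD lam (ofR3 lam (toR3 lam m)) = oneForm lam fun i => toR3 lam (pderiv lam i m) := by
    intro m
    simp [W, oneForm]
  rw [← hmem, eq_top_of_mulX_mem lam (W := W)]
  · exact Submodule.mem_top
  · rw [hmem, toR3_mon_zero, map_one, ← map_one (algebraMap ℂ _), extD_algebraMap]
    simp [pderiv_mon_zero, oneForm]
  · intro a m hm
    rw [hmem] at hm ⊢
    rw [toR3_mulX, map_mul, extD_mul, parity_ofR3, hm, ofR3_x, extD_X, formX_mul_oneForm,
      dCoord_mul_ofR3, oneForm_add]
    simp [pderiv_mulX hlam, toR3_mulX]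

/-- The new one-form appears to the right of the old one, as in `e_i e_j ∂_j a_i`, so the signs are
opposite to the usual ones. -/
theorem extD_oneForm {lam : ℂ} (hlam : lam ≠ 0) (a : Fin 3 → Model) :
    extD lam (oneForm lam fun i => toR3 lam (a i)) =
      twoForm lam (toR3 lam (pderiv lam 1 (a 0) - pderiv lam 0 (a 1)))
        (toR3 lam (pderiv lam 2 (a 0) - pderiv lam 0 (a 2)))
        (toR3 lam (pderiv lam 2 (a 1) - pderiv lam 1 (a 2))) := by
  rw [oneForm, Fin.sum_univ_three]
  simp only [map_add, extD_formE_mul, extD_ofR3_toR3 hlam]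
  simp only [formE, mul_oneForm]
  simp only [basisVec, twoForm, map_sub, mul_sub]
  simp
  abel

theorem extD_twoForm {lam : ℂ} (hlam : lam ≠ 0) (a b c : Model) :
    extD lam (twoForm lam (toR3 lam a) (toR3 lam b) (toR3 lam c)) =
      threeForm lam (toR3 lam (pderiv lam 2 a - pderiv lam 1 b + pderiv lam 0 c)) := by
  simp only [twoForm, map_add, extD_formE_mul, extD_ofR3_toR3 hlam]
  simp only [formE, mul_oneForm, mul_twoForm]
  simp only [basisVec, threeForm, map_sub, map_add, mul_sub, mul_add]
  simp
  abel

/-! ### Closed forms in each degree, and the cohomology. -/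

theorem oneForm_zero (lam : ℂ) : oneForm lam 0 = 0 := by simp [oneForm]

theorem closedForms_zero_le {lam : ℂ} (hlam : lam ≠ 0) :
    closedForms lam 0 ≤ Submodule.span ℂ {1} := by
  rintro ω ⟨hω, hd⟩
  obtain ⟨f, rfl⟩ := (mem_formsDeg_zero lam).1 hω
  obtain ⟨m, rfl⟩ := toR3_surjective lam f
  rw [SetLike.mem_coe, LinearMap.mem_ker, extD_ofR3_toR3 hlam, ← oneForm_zero] at hd
  have hm : ∀ i, pderiv lam i m = 0 := fun i =>
    toR3_injective lam ((congrFun (oneForm_injective lam hd) i).trans (map_zero _).symm)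
  rw [eq_smul_mon_of_pderiv_eq_zero hm, map_smul, toR3_mon_zero, map_smul, map_one]
  exact Submodule.smul_mem _ _ (Submodule.mem_span_singleton_self 1)

theorem closedForms_one_le {lam : ℂ} (hlam : lam ≠ 0) : closedForms lam 1 ≤ exactForms lam 1 := by
  rintro ω ⟨hω, hd⟩
  obtain ⟨f, rfl⟩ := exists_oneForm lam hω
  choose a ha using fun i => toR3_surjective lam (f i)
  obtain rfl : (fun i => toR3 lam (a i)) = f := funext ha
  rw [SetLike.mem_coe, LinearMap.mem_ker, extD_oneForm hlam] at hd
  have inj := fun m => (map_eq_zero_iff (toR3 lam) (toR3_injective lam) (x := m)).1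
  obtain ⟨h01, h02, h12⟩ := eq_zero_of_twoForm_eq_zero lam hd
  have h10 := sub_eq_zero.1 (inj _ h01)
  have h20 := sub_eq_zero.1 (inj _ h02)
  have h21 := sub_eq_zero.1 (inj _ h12)
  obtain ⟨p, hp⟩ := exists_of_pderiv_symm (lam := lam) (a := a) (by
    intro i j
    fin_cases i <;> fin_cases j <;>
      first | rfl | exact h10 | exact h10.symm | exact h20 | exact h20.symm | exact h21
            | exact h21.symm)
  exact ⟨_, ofR3_mem lam (toR3 lam p), by simp only [extD_ofR3_toR3 hlam, hp]⟩

theorem closedForms_two_le {lam : ℂ} (hlam : lam ≠ 0) : closedForms lam 2 ≤ exactForms lam 2 := by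
  rintro ω ⟨hω, hd⟩
  obtain ⟨f, g, h, rfl⟩ := exists_twoForm lam hω
  obtain ⟨a, rfl⟩ := toR3_surjective lam f
  obtain ⟨b, rfl⟩ := toR3_surjective lam g
  obtain ⟨c, rfl⟩ := toR3_surjective lam h
  rw [SetLike.mem_coe, LinearMap.mem_ker, extD_twoForm hlam] at hd
  have h0 := (map_eq_zero_iff (toR3 lam) (toR3_injective lam)).1
    (eq_zero_of_threeForm_eq_zero lam hd)
  obtain ⟨p, rfl, rfl, rfl⟩ := exists_of_pderiv_add_eq_zero h0
  exact ⟨_, oneForm_mem lam fun i => toR3 lam (p i), extD_oneForm hlam p⟩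

theorem closedForms_three_le {lam : ℂ} (hlam : lam ≠ 0) :
    closedForms lam 3 ≤ exactForms lam 3 := by
  rintro ω ⟨hω, -⟩
  obtain ⟨f, rfl⟩ := exists_threeForm lam hω
  obtain ⟨a, rfl⟩ := toR3_surjective lam f
  obtain ⟨p, rfl⟩ := exists_pderiv_two lam a
  -- A primitive of the form `e₁ e₂ p` is enough, since `pderiv lam 2` alone is onto.
  exact ⟨_, twoForm_mem lam (toR3 lam p) (toR3 lam 0) (toR3 lam 0), by
    rw [extD_twoForm hlam, map_zero, map_zero, sub_zero, add_zero]⟩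

theorem subsingleton_H {lam : ℂ} {k : ℕ} (h : closedForms lam k ≤ exactForms lam k) :
    Subsingleton (H lam k) :=
  Submodule.Quotient.subsingleton_iff.2 (Submodule.submoduleOf_eq_top.2 h)

/-- The only exact zero-form is `0`, so the point is that the algebra of forms is nontrivial. It
contains `ℝ³_λ`, which acts unitally on the nonzero model. -/
theorem oneClass_ne_zero (lam : ℂ) : oneClass lam ≠ 0 := by
  have : Nontrivial Model := ⟨mon 0 0 0, 0, by simp [mon]⟩
  intro h
  have h1 : (1 : Forms lam) = 0 := by
    rw [oneClass, Submodule.Quotient.mk_eq_zero] at h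
    exact (Submodule.mem_bot ℂ).1 h
  have h2 : (1 : R3 lam) = 0 := ofR3_injective lam (by rw [map_one, map_zero, h1])
  have h3 : (1 : Module.End ℂ Model) = 0 := by rw [← map_one (action lam), h2, map_zero]
  exact one_ne_zero h3

theorem span_oneClass {lam : ℂ} (hlam : lam ≠ 0) : Submodule.span ℂ {oneClass lam} = ⊤ := by
  rw [eq_top_iff]
  rintro ω -
  obtain ⟨⟨ω, hω⟩, rfl⟩ := Submodule.Quotient.mk_surjective _ ω
  obtain ⟨c, rfl⟩ := Submodule.mem_span_singleton.1 (closedForms_zero_le hlam hω)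
  exact Submodule.mem_span_singleton.2 ⟨c, rfl⟩

end R3Calculus

end

theorem mainTheorem1 (lam : ℂ) (hlam : lam ≠ 0) :
    (Submodule.span ℂ {R3Calculus.oneClass lam} = ⊤ ∧ R3Calculus.oneClass lam ≠ 0) ∧
      Subsingleton (R3Calculus.H lam 1) ∧
      Subsingleton (R3Calculus.H lam 2) ∧
      Subsingleton (R3Calculus.H lam 3) :=
  ⟨⟨R3Calculus.span_oneClass hlam, R3Calculus.oneClass_ne_zero lam⟩,
    R3Calculus.subsingleton_H (R3Calculus.closedForms_one_le hlam),
    R3Calculus.subsingleton_H (R3Calculus.closedForms_two_le hlam),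
    R3Calculus.subsingleton_H (R3Calculus.closedForms_three_le hlam)⟩
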